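/- A product state of $\mathbb{C}^3\otimes\mathbb{C}^4$ is a vector $a\otimes b$ with $a\in\mathbb{C}^3$, $b\in\mathbb{C}^4$ unit vectors. For subspaces $A\subseteq\mathbb{C}^3$, $B\subseteq\mathbb{C}^4$, an unextendible product basis (UPB) of $A\otimes B$ is a set of pairwise orthogonal product states $a\otimes b$ with $a\in A$, $b\in B$, which does not span $A\otimes B$ and such that no product state of $A\otimes B$ is orthogonal to all its members. An LOCC protocol is a finite tree of rounds in which, depending on the earlier outcomes, one of the two parties applies a measurement $\{K_i\}_i$, $\sum_i K_i^\dagger K_i=\mathbb{I}$, to its own factor. It is orthogonality-preserving on a set $S$ of states if after every round, for every sequence of outcomes, the (unnormalized) post-measurement vectors of the states of $S$ are pairwise orthogonal. A subset $U\subseteq S$ can be eliminated from $S$ by orthogonality-preserving LOCC if such a protocol has a sequence of outcomes after which exactly the states of $U$, but not all states of $S$, have post-measurement vector zero. A UPB is reducible if some nonempty subset of it can be eliminated in this way. Proposition. Every reducible UPB $S$ of $\mathbb{C}^3\otimes\mathbb{C}^4$ has exactly eight elements. Moreover, $S$ is the disjoint union of a set $T$ of five states which is a UPB of a $3\otimes3$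 subspace $A\otimes B$ (with $A\subseteq\mathbb{C}^3$, $B\subseteq\mathbb{C}^4$, $\dim A=\dim B=3$), and a set $U$ of three product states which can be eliminated from $S$ by orthogonality-preserving LOCC. -/

import Mathlib

open scoped TensorProduct InnerProductSpace

section ProductBases

variable {HA HB : Type*}
  [NormedAddCommGroup HA] [InnerProductSpace ℂ HA] [FiniteDimensional ℂ HA]
  [NormedAddCommGroup HB] [InnerProductSpace ℂ HB] [FiniteDimensional ℂ HB]

/-- `x` is (a unit vector representing) a pure product state of the product subspace `A ⊗ B`
of the bipartite Hilbert space `HA ⊗ HB`. -/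
def IsProductState (A : Submodule ℂ HA) (B : Submodule ℂ HB) (x : HA ⊗[ℂ] HB) : Prop :=
  ∃ a ∈ A, ∃ b ∈ B, ‖a‖ = 1 ∧ ‖b‖ = 1 ∧ x = a ⊗ₜ[ℂ] b

/-- The product subspace `A ⊗ B` of `HA ⊗ HB`. -/
def productSubspace (A : Submodule ℂ HA) (B : Submodule ℂ HB) : Submodule ℂ (HA ⊗[ℂ] HB) :=
  Submodule.span ℂ {x | ∃ a ∈ A, ∃ b ∈ B, x = a ⊗ₜ[ℂ] b}

/-- `S` is an unextendible product basis of the product subspace `A ⊗ B`: a set of pairwise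
orthogonal product states of `A ⊗ B` which does not span `A ⊗ B`, and such that no product state
of `A ⊗ B` lies in the orthogonal complement of the span of `S`. -/
structure IsUPBIn (A : Submodule ℂ HA) (B : Submodule ℂ HB) (S : Set (HA ⊗[ℂ] HB)) : Prop where
  product : ∀ s ∈ S, IsProductState A B s
  orthogonal : S.Pairwise fun s t => ⟪s, t⟫_ℂ = 0
  incomplete : Submodule.span ℂ S < productSubspace A B
  unextendible : ∀ x, IsProductState A B x → x ∉ (Submodule.span ℂ S)ᗮ

/-- An unextendible product basis of the whole Hilbert space `HA ⊗ HB`. -/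
def IsUPB (S : Set (HA ⊗[ℂ] HB)) : Prop :=
  IsUPBIn ⊤ ⊤ S

/-- A finite family of measurement (Kraus) operators on a Hilbert space. -/
def IsMeasurement {H : Type*} [NormedAddCommGroup H] [InnerProductSpace ℂ H]
    [FiniteDimensional ℂ H] {k : ℕ} (K : Fin k → (H →ₗ[ℂ] H)) : Prop :=
  ∑ i, LinearMap.adjoint (K i) ∘ₗ K i = LinearMap.id

variable (HA HB) in
/-- A (finite-round) LOCC protocol: either finish, or let one of the two parties perform a
measurement on the own subsystem and announce the outcome `i`, and continue with a protocol that
may depend on `i` (and hence on all earlier outcomes). -/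
inductive LOCC where
  | halt : LOCC
  | alice (k : ℕ) (K : Fin k → (HA →ₗ[ℂ] HA)) (hK : IsMeasurement K) (next : Fin k → LOCC) : LOCC
  | bob (k : ℕ) (K : Fin k → (HB →ₗ[ℂ] HB)) (hK : IsMeasurement K) (next : Fin k → LOCC) : LOCC

/-- The operators on `HA ⊗ HB` that have been applied to the (unnormalized) state at the various
stages of the protocol, one for each sequence of outcomes up to some round; the identity is the
operator before the first round. -/
def LOCC.stageOps : LOCC HA HB → Set ((HA ⊗[ℂ] HB) →ₗ[ℂ] (HA ⊗[ℂ] HB))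
  | .halt => {LinearMap.id}
  | .alice _ K _ next =>
      {L | L = LinearMap.id ∨
        ∃ i, ∃ L' ∈ (next i).stageOps, L = L' ∘ₗ TensorProduct.map (K i) LinearMap.id}
  | .bob _ K _ next =>
      {L | L = LinearMap.id ∨
        ∃ i, ∃ L' ∈ (next i).stageOps, L = L' ∘ₗ TensorProduct.map LinearMap.id (K i)}

/-- The protocol keeps the states of `S` pairwise orthogonal after every round, for every sequence
of outcomes (a state that is no longer possible has become the zero vector). -/
def LOCC.OrthogonalityPreserving (P : LOCC HA HB) (S : Set (HA ⊗[ℂ] HB)) : Prop :=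
  ∀ L ∈ P.stageOps, S.Pairwise fun s t => ⟪L s, L t⟫_ℂ = 0

/-- The set `U` of states of `S` can be eliminated by orthogonality-preserving LOCC: for some
orthogonality-preserving protocol there is a sequence of outcomes that has probability zero exactly
for those states of `S` that belong to `U`. It has to be a sequence that can occur at all, that is,
some state of `S` survives. -/
def CanEliminate (S U : Set (HA ⊗[ℂ] HB)) : Prop :=
  ∃ P : LOCC HA HB, P.OrthogonalityPreserving S ∧
    ∃ L ∈ P.stageOps, U = {s ∈ S | L s = 0} ∧ ∃ s ∈ S, L s ≠ 0

/-- A reducible unextendible product basis: at least one of its states can be eliminated by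
orthogonality-preserving LOCC. -/
def IsReducibleUPB (S : Set (HA ⊗[ℂ] HB)) : Prop :=
  IsUPB S ∧ ∃ U : Set (HA ⊗[ℂ] HB), U.Nonempty ∧ CanEliminate S U

end ProductBases

/-! Only the first non-scalar measurement matters. As long as `K†K` is scalar, the operators applied
are multiples of unitaries and kill no state, so along an eliminating branch some party must apply
an operator whose `N = K†K` (pulled back through the earlier unitaries) is not scalar and yet keeps
the original states orthogonal. Testing unextendibility on `a i ⊗ (N b i - ⟪b i, N b i⟫ b i)` shows
that every local vector is an eigenvector of `N` (`apply_eq_smul`). Hence an eigenspace `V` and its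
complement split the local vectors, and both halves are again unextendible in their own product
spaces.

Unextendible families with a local dimension at most 2 are complete
(`span_eq_top_of_finrank_left_le_two`). A split 2+1 of Alice's space or 2+2 of Bob's would therefore
make `S` complete, so Bob's space splits as 3+1. The one-dimensional part is complete, with 3
states; the other is an incomplete unextendible family in a 3×3 space.

Such a family has exactly 5 states (`card_eq_five`). At most 4 could be shared between the two
factors, two each, and so extended. With 6 or more, the complement `W` has dimension at most 3.
Conjugating one factor keeps the family orthonormal, so the projection to `W` has positive partial
transpose; `exists_contraction` turns this into a product vector in `W`, a contradiction. -/

open Module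

/-! ### Linear families of maps with a partial-transpose positivity condition -/

section OperatorPencils

variable {A B W : Type*}
  [AddCommGroup A] [Module ℂ A]
  [NormedAddCommGroup B] [InnerProductSpace ℂ B] [FiniteDimensional ℂ B]
  [NormedAddCommGroup W] [InnerProductSpace ℂ W]

/-- In a linear family of maps, a member of maximal rank maps its kernel, under any other member,
into its own range. -/
theorem apply_mem_range_of_maximal_rank (Z : A →ₗ[ℂ] B →ₗ[ℂ] W) {β : A}
    (hβ : ∀ γ, finrank ℂ (LinearMap.range (Z γ)) ≤ finrank ℂ (LinearMap.range (Z β)))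
    (α : A) {c : B} (hc : Z β c = 0) : Z α c ∈ LinearMap.range (Z β) := by
  by_contra hα
  let e := Module.finBasis ℂ (LinearMap.range (Z β))
  choose u hu using fun i => (e i).2
  have hli : LinearIndependent ℂ (fun i => Z β (u i)) := by
    have h := e.linearIndependent.map' (LinearMap.range (Z β)).subtype (Submodule.ker_subtype _)
    have hc : (fun i => Z β (u i)) = (LinearMap.range (Z β)).subtype ∘ e := funext hu
    rwa [hc]
  -- For `t ≠ 0` all entries lie in the range of `Z (β + t • α)`, the first because `Z β c = 0`.
  -- Independence at `t = 0` is an open condition, so for some small `t ≠ 0` the rank would exceed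
  -- the maximum.
  let f : ℂ → Fin (finrank ℂ (LinearMap.range (Z β)) + 1) → W :=
    fun t => Fin.cons (Z α c) (fun i => Z β (u i) + t • Z α (u i))
  have hf0 : LinearIndependent ℂ (f 0) := by
    simp only [f, zero_smul, add_zero]
    refine linearIndependent_finCons.2 ⟨hli, fun h => hα ?_⟩
    refine Submodule.span_le.2 ?_ h
    rintro _ ⟨i, rfl⟩
    exact ⟨u i, rfl⟩
  have hfc : Continuous f := by
    refine continuous_pi fun i => ?_
    refine Fin.cases ?_ (fun i => ?_) i
    · simp only [f, Fin.cons_zero]; exact continuous_const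
    · simp only [f, Fin.cons_succ]; fun_prop
  have hev : ∀ᶠ t in nhds (0 : ℂ), LinearIndependent ℂ (f t) :=
    hfc.continuousAt.eventually (isOpen_setOfPred_linearIndependent.mem_nhds hf0)
  obtain ⟨t, ht, ht0⟩ := ((hev.filter_mono nhdsWithin_le_nhds).and
    (self_mem_nhdsWithin : {(0 : ℂ)}ᶜ ∈ nhdsWithin 0 {(0 : ℂ)}ᶜ)).exists
  have ht0 : t ≠ 0 := ht0
  have hmem : ∀ i, f t i ∈ LinearMap.range (Z (β + t • α)) := by
    intro i
    refine Fin.cases ?_ (fun i => ?_) i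
    · exact ⟨t⁻¹ • c, by simp [f, hc, ht0]⟩
    · exact ⟨u i, by simp [f]⟩
  have hle := Submodule.finrank_mono (Submodule.span_le.2 (Set.range_subset_iff.2 hmem))
  rw [finrank_span_eq_card ht, Fintype.card_fin] at hle
  have := hβ (β + t • α)
  omega

variable [FiniteDimensional ℂ W]

/-- A pencil of square matrices contains a singular member. -/
theorem exists_not_surjective_of_pencil [FiniteDimensional ℂ A] [Nontrivial W]
    (h : finrank ℂ A = finrank ℂ W)
    (X Y : A →ₗ[ℂ] W) :
    ∃ s t : ℂ, (s ≠ 0 ∨ t ≠ 0) ∧ ¬ Function.Surjective (s • X + t • Y) := by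
  by_cases hY : Function.Surjective Y
  · obtain ⟨G, hG⟩ := Y.exists_rightInverse_of_surjective (LinearMap.range_eq_top.2 hY)
    obtain ⟨μ, hμ⟩ := Module.End.exists_eigenvalue (X ∘ₗ G)
    obtain ⟨w, hw⟩ := hμ.exists_hasEigenvector
    refine ⟨1, -μ, Or.inl one_ne_zero, fun hs => ?_⟩
    have hinj := (LinearMap.injective_iff_surjective_of_finrank_eq_finrank h).2 hs
    have hYG : Y (G w) = w := LinearMap.congr_fun hG w
    have hGw : G w = 0 := by
      apply hinj
      have := hw.apply_eq_smul
      simp only [LinearMap.comp_apply] at this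
      simp [this, hYG]
    exact hw.2 (by rw [← hYG, hGw, map_zero])
  · exact ⟨0, 1, Or.inr one_ne_zero, by simpa using hY⟩

/-- A linear family of operators in which every kernel is invariant under the whole family, and
which contains the identity, has a common eigenvector. -/
theorem exists_common_eigenvector [Nontrivial W] (F : A →ₗ[ℂ] Module.End ℂ W) (β : A)
    (hβ : F β = LinearMap.id)
    (hker : ∀ γ α w, F γ w = 0 → F γ (F α w) = 0) :
    ∃ w ≠ 0, ∀ α, ∃ μ : ℂ, F α w = μ • w := by
  classical
  -- In a nonzero invariant subspace of least dimension, each eigenspace of `F γ` is the kernel of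
  -- `F (γ - μ • β)`, hence invariant, hence everything.
  let P : ℕ → Prop := fun n => ∃ E : Submodule ℂ W, E ≠ ⊥ ∧ (∀ α, ∀ w ∈ E, F α w ∈ E) ∧
    finrank ℂ E = n
  have hP : ∃ n, P n := ⟨_, ⊤, top_ne_bot, by simp, rfl⟩
  obtain ⟨E, hE, hinv, hn⟩ := Nat.find_spec hP
  obtain ⟨w, hwE, hw⟩ := Submodule.exists_mem_ne_zero_of_ne_bot hE
  refine ⟨w, hw, fun γ => ?_⟩
  have : Nontrivial E := Submodule.nontrivial_iff_ne_bot.2 hE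
  obtain ⟨μ, hμ⟩ := Module.End.exists_eigenvalue ((F γ).restrict (hinv γ))
  obtain ⟨v, hv⟩ := hμ.exists_hasEigenvector
  refine ⟨μ, ?_⟩
  have hγ : ∀ x, F (γ - μ • β) x = F γ x - μ • x := by simp [hβ]
  have hv' : F γ v = μ • (v : W) := by
    simpa using congrArg Subtype.val hv.apply_eq_smul
  have hle : E ⊓ LinearMap.ker (F (γ - μ • β)) ≤ E := inf_le_left
  have heq : E ⊓ LinearMap.ker (F (γ - μ • β)) = E := by
    refine Submodule.eq_of_le_of_finrank_le hle ?_
    rw [hn]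
    refine Nat.find_min' hP ⟨_, ?_, ?_, rfl⟩
    · refine (Submodule.ne_bot_iff _).2 ⟨v, ⟨v.2, ?_⟩, by simpa using hv.2⟩
      simp only [SetLike.mem_coe, LinearMap.mem_ker, hγ, hv', sub_self]
    · rintro α x ⟨hx, hx'⟩
      exact ⟨hinv α x hx, hker _ _ _ hx'⟩
  have hwk : w ∈ LinearMap.ker (F (γ - μ • β)) := (heq.symm ▸ hwE : w ∈ E ⊓ _).2
  rw [LinearMap.mem_ker, hγ, sub_eq_zero] at hwk
  exact hwk

/-- If one of the maps `Z β` is onto, there is a nonzero `w : W` all of whose contractions with the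
family `Z` are proportional to one vector `y`. -/
theorem exists_contraction_of_surjective [Nontrivial W] (Z : A →ₗ[ℂ] B →ₗ[ℂ] W)
    (hZ : ∀ β c, Z β c = 0 → ∀ α b, ⟪Z β b, Z α c⟫_ℂ = 0)
    {β : A} (hβ : Function.Surjective (Z β)) :
    ∃ w ≠ 0, ∃ y ≠ 0, ∀ α b, ⟪y, b⟫_ℂ = 0 → ⟪w, Z α b⟫_ℂ = 0 := by
  obtain ⟨G, hG⟩ := (Z β).exists_rightInverse_of_surjective (LinearMap.range_eq_top.2 hβ)
  have hG' : ∀ w, Z β (G w) = w := LinearMap.congr_fun hG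
  let F : A →ₗ[ℂ] Module.End ℂ W := (LinearMap.lcomp ℂ W G) ∘ₗ Z
  have hF : ∀ α w, F α w = Z α (G w) := fun _ _ => rfl
  -- The kernel of `Z β` is killed by every `Z α`: by `hZ` its image is orthogonal to the range of
  -- `Z β`, which is all of `W`.
  have hfac : ∀ α b, Z α b = F α (Z β b) := by
    intro α b
    have h0 : Z β (b - G (Z β b)) = 0 := by rw [map_sub, hG', sub_self]
    have h1 := hZ β _ h0 α (G (Z α (b - G (Z β b))))
    rw [hG', inner_self_eq_zero, map_sub, sub_eq_zero] at h1
    rw [h1, hF]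
  have hadj : ∀ γ α w, F γ w = 0 → LinearMap.adjoint (F γ) (F α w) = 0 := by
    intro γ α w h
    refine ext_inner_left ℂ fun v => ?_
    rw [LinearMap.adjoint_inner_right, inner_zero_right]
    exact hZ γ (G w) h α (G v)
  have hβF : F β = LinearMap.id := LinearMap.ext hG'
  have hle : ∀ γ, LinearMap.ker (F γ) ≤ LinearMap.ker (LinearMap.adjoint (F γ)) := by
    intro γ w hw
    have := hadj γ β w hw
    rwa [hβF] at this
  -- `F γ` and its adjoint have equal rank, so the inclusion is an equality; with `hadj` it makes
  -- all kernels invariant.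
  have hkereq : ∀ γ, LinearMap.ker (F γ) = LinearMap.ker (LinearMap.adjoint (F γ)) := by
    intro γ
    refine Submodule.eq_of_le_of_finrank_le (hle γ) ?_
    have h1 := (F γ).finrank_range_add_finrank_ker
    have h2 := (LinearMap.adjoint (F γ)).finrank_range_add_finrank_ker
    have h3 := LinearMap.finrank_range_adjoint (F γ)
    omega
  obtain ⟨w, hw, hev⟩ := exists_common_eigenvector F β hβF (fun γ α w h => by
    rw [← LinearMap.mem_ker, hkereq]; exact hadj γ α w h)
  refine ⟨w, hw, LinearMap.adjoint (Z β) w, fun h => hw ?_, fun α b hb => ?_⟩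
  · obtain ⟨b, rfl⟩ := hβ w
    rw [← inner_self_eq_zero (𝕜 := ℂ), ← LinearMap.adjoint_inner_right, h, inner_zero_right]
  · rw [LinearMap.adjoint_inner_left] at hb
    obtain ⟨μ, hμ⟩ := hev α
    -- By `hle`, `w` is an eigenvector of the adjoint of `F α` as well, so `⟪w, Z α b⟫` is a
    -- multiple of `⟪w, Z β b⟫ = ⟪y, b⟫`.
    have hs : F (α - μ • β) w = 0 := by simp [hβF, hμ]
    have hs' := hle _ hs
    rw [LinearMap.mem_ker] at hs'
    have h2 : ⟪w, F (α - μ • β) (Z β b)⟫_ℂ = 0 := by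
      rw [← LinearMap.adjoint_inner_left, hs', inner_zero_left]
    rw [hfac]
    simpa [hβF, inner_sub_right, inner_smul_right, hb] using h2

/-- A subspace of codimension at most one contains the orthogonal complement of some nonzero
vector. -/
theorem exists_orthogonal_subset (L : Submodule ℂ B) (hB : 0 < finrank ℂ B)
    (hL : finrank ℂ B ≤ finrank ℂ L + 1) : ∃ y ≠ 0, ∀ b, ⟪y, b⟫_ℂ = 0 → b ∈ L := by
  by_cases h : L = ⊤
  · have : Nontrivial B := Module.nontrivial_of_finrank_pos hB
    obtain ⟨y, hy⟩ := exists_ne (0 : B)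
    exact ⟨y, hy, by simp [h]⟩
  · obtain ⟨y, hyL, hy⟩ := Submodule.exists_mem_ne_zero_of_ne_bot
      (fun h' => h (Submodule.orthogonal_eq_bot_iff.1 h'))
    refine ⟨y, hy, fun b hb => ?_⟩
    have hle : L ≤ (Submodule.span ℂ {y})ᗮ := fun x hx =>
      Submodule.mem_orthogonal_singleton_iff_inner_right.2
        (Submodule.inner_left_of_mem_orthogonal hx hyL)
    have h1 := (Submodule.span ℂ {y}).finrank_add_finrank_orthogonal
    rw [finrank_span_singleton hy] at h1
    rw [Submodule.eq_of_le_of_finrank_le hle (by omega)]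
    exact Submodule.mem_orthogonal_singleton_iff_inner_right.2 hb

/-- If `Z` is a family of maps between spaces of dimension at most three, there is a nonzero `w : W`
all of whose contractions with the family are proportional to one vector `y`. -/
theorem exists_contraction [Nontrivial W] (Z : A →ₗ[ℂ] B →ₗ[ℂ] W)
    (hZ : ∀ β c, Z β c = 0 → ∀ α b, ⟪Z β b, Z α c⟫_ℂ = 0)
    (hA : finrank ℂ A = 3) (hB : finrank ℂ B = 3) (hW : finrank ℂ W ≤ 3) :
    ∃ w ≠ 0, ∃ y ≠ 0, ∀ α b, ⟪y, b⟫_ℂ = 0 → ⟪w, Z α b⟫_ℂ = 0 := by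
  by_cases hsurj : ∃ β, Function.Surjective (Z β)
  · exact exists_contraction_of_surjective Z hZ hsurj.choose_spec
  push Not at hsurj
  have hbdd : BddAbove (Set.range fun γ => finrank ℂ (LinearMap.range (Z γ))) :=
    ⟨finrank ℂ W, by rintro _ ⟨γ, rfl⟩; exact Submodule.finrank_le _⟩
  obtain ⟨β, hβ⟩ := Nat.sSup_mem (Set.range_nonempty _) hbdd
  have hmax : ∀ γ, finrank ℂ (LinearMap.range (Z γ)) ≤ finrank ℂ (LinearMap.range (Z β)) :=
    fun γ => (le_csSup hbdd ⟨γ, rfl⟩).trans_eq hβ.symm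
  -- By maximal rank `Z α c` lies in the range of `Z β`, and by `hZ` it is orthogonal to that range.
  have hK : ∀ c ∈ LinearMap.ker (Z β), ∀ α, Z α c = 0 := by
    intro c hc α
    obtain ⟨b, hb⟩ := apply_mem_range_of_maximal_rank Z hmax α hc
    have := hZ β c hc α b
    rwa [hb, inner_self_eq_zero] at this
  set K := LinearMap.ker (Z β)
  have hrk := (Z β).finrank_range_add_finrank_ker
  have hKo := K.finrank_add_finrank_orthogonal
  have hlt : finrank ℂ (LinearMap.range (Z β)) < finrank ℂ W :=
    Submodule.finrank_lt (fun h => hsurj β (LinearMap.range_eq_top.1 h))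
  have hKdef : finrank ℂ (LinearMap.range (Z β)) + finrank ℂ K = 3 := hB ▸ hrk
  -- Rank two: `K` is one dimension short of a hyperplane. The missing direction `g` comes from a
  -- singular member of the square pencil `α ↦ Z α (e i)`, and `w` is orthogonal to the range of
  -- that member.
  by_cases hK2 : finrank ℂ K = 1
  · have hW3 : finrank ℂ W = 3 := by omega
    have hKo2 : finrank ℂ Kᗮ = 2 := by omega
    let e := Module.finBasisOfFinrankEq ℂ Kᗮ hKo2
    have : FiniteDimensional ℂ A := FiniteDimensional.of_finrank_pos (by omega)
    obtain ⟨s, t, hst, hns⟩ := exists_not_surjective_of_pencil (hA.trans hW3.symm)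
      (Z.flip (e 0)) (Z.flip (e 1))
    let g : Kᗮ := s • e 0 + t • e 1
    have hg0 : g ≠ 0 := by
      intro h
      have h0 := congrArg (fun x => e.repr x 0) h
      have h1 := congrArg (fun x => e.repr x 1) h
      simp [g] at h0 h1
      tauto
    have hgK : (g : B) ∉ K := fun h => hg0 (Subtype.ext
      (inner_self_eq_zero (𝕜 := ℂ).1 (g.2 _ h)))
    have hlt : K < K ⊔ Submodule.span ℂ {(g : B)} :=
      lt_of_le_of_ne le_sup_left fun h => hgK (h.ge (Submodule.mem_sup_right
        (Submodule.mem_span_singleton_self _)))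
    have := Submodule.finrank_lt_finrank_of_lt hlt
    obtain ⟨y, hy, hyL⟩ := exists_orthogonal_subset (K ⊔ Submodule.span ℂ {(g : B)})
      (by omega) (by omega)
    have hr : LinearMap.range (s • Z.flip (e 0) + t • Z.flip (e 1)) ≠ ⊤ :=
      fun h => hns (LinearMap.range_eq_top.1 h)
    obtain ⟨w, hwr, hw⟩ := Submodule.exists_mem_ne_zero_of_ne_bot
      (fun h => hr (Submodule.orthogonal_eq_bot_iff.1 h))
    refine ⟨w, hw, y, hy, fun α b hb => ?_⟩
    obtain ⟨k, hk, z, hz, rfl⟩ := Submodule.mem_sup.1 (hyL b hb)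
    obtain ⟨c, rfl⟩ := Submodule.mem_span_singleton.1 hz
    have h1 := (Submodule.mem_orthogonal' _ _).1 hwr _ ⟨α, rfl⟩
    have h2 : ⟪w, Z α g⟫_ℂ = 0 := by simpa [g, inner_add_right, inner_smul_right] using h1
    rw [map_add, hK k hk, zero_add, map_smul, inner_smul_right, h2, mul_zero]
  -- Rank at most one: the common kernel already contains a hyperplane, so any `w` works.
  · obtain ⟨y, hy, hyL⟩ := exists_orthogonal_subset K (by omega) (by omega)
    obtain ⟨w, hw⟩ := exists_ne (0 : W)
    exact ⟨w, hw, y, hy, fun α b hb => by rw [hK b (hyL b hb), inner_zero_right]⟩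

end OperatorPencils

/-! ### Projections, antiunitaries and orthogonal vectors -/

section OrthogonalComplements

variable {E : Type*} [NormedAddCommGroup E] [InnerProductSpace ℂ E]

/-- The Gram matrix of vectors projected to the orthogonal complement of an orthonormal family. -/
theorem Orthonormal.inner_projection_orthogonal_span [FiniteDimensional ℂ E]
    {ι : Type*} [Fintype ι] {v : ι → E}
    (hv : Orthonormal ℂ v) (x y : E) :
    ⟪(Submodule.span ℂ (Set.range v))ᗮ.starProjection x,
      (Submodule.span ℂ (Set.range v))ᗮ.starProjection y⟫_ℂ =
      ⟪x, y⟫_ℂ - ∑ i, ⟪x, v i⟫_ℂ * ⟪v i, y⟫_ℂ := by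
  classical
  have hy : (Submodule.span ℂ (Set.range v))ᗮ.starProjection y =
      y - ∑ i, ⟪v i, y⟫_ℂ • v i := by
    refine (Submodule.eq_starProjection_of_mem_orthogonal ?_ ?_)
    · rw [Submodule.mem_orthogonal]
      intro u hu
      induction hu using Submodule.span_induction with
      | mem u hu =>
        obtain ⟨i, rfl⟩ := hu
        rw [inner_sub_right, hv.inner_right_fintype, sub_self]
      | zero => simp
      | add u u' _ _ h h' => rw [inner_add_left, h, h', add_zero]
      | smul c u _ h => rw [inner_smul_left, h, mul_zero]
    · rw [sub_sub_cancel]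
      exact Submodule.le_orthogonal_orthogonal _ (Submodule.sum_mem _ fun i _ =>
        Submodule.smul_mem _ _ (Submodule.subset_span ⟨i, rfl⟩))
  rw [Submodule.inner_starProjection_left_eq_right,
    Submodule.starProjection_eq_self_iff.2 (Submodule.starProjection_apply_mem _ y), hy,
    inner_sub_right, inner_sum]
  simp only [inner_smul_right, mul_comm]

/-- An antiunitary map exists on every finite-dimensional Hilbert space. -/
theorem exists_antiunitary (E : Type*) [NormedAddCommGroup E] [InnerProductSpace ℂ E]
    [FiniteDimensional ℂ E] : ∃ J : E → E, ∀ x y, ⟪J x, J y⟫_ℂ = ⟪y, x⟫_ℂ := by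
  let e := stdOrthonormalBasis ℂ E
  refine ⟨fun x => e.repr.symm (WithLp.toLp 2 fun i => star (e.repr x i)), fun x y => ?_⟩
  rw [LinearIsometryEquiv.inner_map_map, ← e.repr.inner_map_map, PiLp.inner_apply, PiLp.inner_apply]
  refine Finset.sum_congr rfl fun i _ => ?_
  simp [mul_comm]

theorem exists_ne_zero_forall_inner_eq_zero {ι : Type*} (v : ι → E) (s : Finset ι)
    (hs : s.card < finrank ℂ E) : ∃ x ≠ 0, ∀ i ∈ s, ⟪v i, x⟫_ℂ = 0 := by
  classical
  have hle : finrank ℂ (Submodule.span ℂ (s.image v : Set E)) ≤ s.card :=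
    (finrank_span_finset_le_card _).trans Finset.card_image_le
  obtain ⟨x, hx, hx0⟩ := Submodule.exists_mem_ne_zero_of_ne_bot
    (p := (Submodule.span ℂ (s.image v : Set E))ᗮ) (fun h => by
      rw [Submodule.orthogonal_eq_bot_iff] at h
      rw [h, finrank_top] at hle
      omega)
  exact ⟨x, hx0, fun i hi => hx _ (Submodule.subset_span (by simpa using ⟨i, hi, rfl⟩))⟩

end OrthogonalComplements

/-! ### Recognizing product vectors -/

section ProductVectors

variable {A B : Type*}
  [NormedAddCommGroup A] [InnerProductSpace ℂ A] [FiniteDimensional ℂ A]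
  [NormedAddCommGroup B] [InnerProductSpace ℂ B] [FiniteDimensional ℂ B]

/-- A tensor whose contraction with every vector is proportional to `y` is a product vector. -/
theorem exists_eq_tmul_of_inner_eq_zero {w : A ⊗[ℂ] B} {y : B} (hy : y ≠ 0)
    (h : ∀ α b, ⟪y, b⟫_ℂ = 0 → ⟪w, α ⊗ₜ[ℂ] b⟫_ℂ = 0) : ∃ x, w = x ⊗ₜ[ℂ] y := by
  have hyy : ⟪y, y⟫_ℂ ≠ 0 := inner_self_ne_zero.2 hy
  let x := LinearMap.adjoint ((TensorProduct.mk ℂ A B).flip y) w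
  have hx : ∀ α, ⟪x, α⟫_ℂ = ⟪w, α ⊗ₜ[ℂ] y⟫_ℂ := fun α => LinearMap.adjoint_inner_left _ _ _
  refine ⟨(⟪y, y⟫_ℂ)⁻¹ • x, TensorProduct.ext_iff_inner_right.2 fun α b => ?_⟩
  have h0 := h α (b - (⟪y, b⟫_ℂ / ⟪y, y⟫_ℂ) • y) (by
    rw [inner_sub_right, inner_smul_right, div_mul_cancel₀ _ hyy, sub_self])
  rw [TensorProduct.tmul_sub, TensorProduct.tmul_smul, inner_sub_right,
    inner_smul_right (𝕜 := ℂ) (E := A ⊗[ℂ] B), sub_eq_zero] at h0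
  rw [h0, TensorProduct.inner_tmul, inner_smul_left, hx, map_inv₀, inner_conj_symm]
  ring

end ProductVectors

/-! ### Unextendible families in dimensions 2×n and 3×3 -/

section ProductFamilies

variable {ι A B : Type*}
  [NormedAddCommGroup A] [InnerProductSpace ℂ A]
  [NormedAddCommGroup B] [InnerProductSpace ℂ B]

/-- The product vectors `a i ⊗ b i` are pairwise orthogonal unit vectors, and no product vector is
orthogonal to all of them. -/
structure IsUnextendible (a : ι → A) (b : ι → B) : Prop where
  norm_left : ∀ i, ‖a i‖ = 1
  norm_right : ∀ i, ‖b i‖ = 1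
  orthogonal : ∀ i j, i ≠ j → ⟪a i, a j⟫_ℂ = 0 ∨ ⟪b i, b j⟫_ℂ = 0
  unextendible : ∀ x y, x ≠ 0 → y ≠ 0 → ∃ i, ⟪a i, x⟫_ℂ ≠ 0 ∧ ⟪b i, y⟫_ℂ ≠ 0

namespace IsUnextendible

variable {a : ι → A} {b : ι → B}

theorem swap (h : IsUnextendible a b) : IsUnextendible b a where
  norm_left := h.norm_right
  norm_right := h.norm_left
  orthogonal i j hij := (h.orthogonal i j hij).symm
  unextendible x y hx hy := (h.unextendible y x hy hx).imp fun _ => And.symm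

theorem left_ne_zero (h : IsUnextendible a b) (i : ι) : a i ≠ 0 :=
  norm_ne_zero_iff.1 (by rw [h.norm_left]; exact one_ne_zero)

theorem right_ne_zero (h : IsUnextendible a b) (i : ι) : b i ≠ 0 := h.swap.left_ne_zero i

theorem orthonormal (h : IsUnextendible a b) : Orthonormal ℂ fun i => a i ⊗ₜ[ℂ] b i := by
  refine ⟨fun i => by simp [h.norm_left, h.norm_right], fun i j hij => ?_⟩
  change ⟪a i ⊗ₜ[ℂ] b i, a j ⊗ₜ[ℂ] b j⟫_ℂ = 0
  rw [TensorProduct.inner_tmul]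
  exact mul_eq_zero.2 (h.orthogonal i j hij)

/-- The vectors that lie in a subspace which, together with its orthogonal complement, contains
all the vectors of the family. -/
theorem restrict_right (h : IsUnextendible a b) (V : Submodule ℂ B) (hV : ∀ i, b i ∈ V ∨ b i ∈ Vᗮ) :
    IsUnextendible (fun i : {i // b i ∈ V} => a i)
      (fun i : {i // b i ∈ V} => (⟨b i, i.2⟩ : V)) where
  norm_left i := h.norm_left i
  norm_right i := h.norm_right i
  orthogonal i j hij := h.orthogonal i j (fun h => hij (Subtype.ext h))
  unextendible x y hx hy := by
    obtain ⟨i, hi, hi'⟩ := h.unextendible x y hx (by simpa using hy)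
    exact ⟨⟨i, (hV i).resolve_right fun hb =>
      hi' (Submodule.inner_left_of_mem_orthogonal y.2 hb)⟩, hi, hi'⟩

/-- An operator that preserves the orthogonality of an unextendible family has all local vectors
of the family as eigenvectors. -/
theorem apply_eq_smul (h : IsUnextendible a b) (N : B →ₗ[ℂ] B)
    (hN : ∀ i j, i ≠ j → ⟪a i, a j⟫_ℂ = 0 ∨ ⟪b i, N (b j)⟫_ℂ = 0) (i : ι) :
    N (b i) = ⟪b i, N (b i)⟫_ℂ • b i := by
  by_contra hne
  obtain ⟨j, hj, hj'⟩ := h.unextendible (a i) (N (b i) - ⟪b i, N (b i)⟫_ℂ • b i)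
    (h.left_ne_zero i) (sub_ne_zero.2 hne)
  rw [inner_sub_right, inner_smul_right] at hj'
  by_cases hij : j = i
  · subst hij
    simp [inner_self_eq_norm_sq_to_K, h.norm_right] at hj'
  · simp [(hN j i hij).resolve_left hj, (h.orthogonal j i hij).resolve_left hj] at hj'

theorem span_eq_top_swap
    (hT : Submodule.span ℂ (Set.range fun i => b i ⊗ₜ[ℂ] a i) = ⊤) :
    Submodule.span ℂ (Set.range fun i => a i ⊗ₜ[ℂ] b i) = ⊤ := by
  have h1 := congrArg (Submodule.map (TensorProduct.comm ℂ B A).toLinearMap) hT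
  rw [Submodule.map_span, ← Set.range_comp, Submodule.map_top, LinearEquiv.range] at h1
  exact h1

variable [FiniteDimensional ℂ A] [FiniteDimensional ℂ B]

theorem finite (h : IsUnextendible a b) : Finite ι := h.orthonormal.linearIndependent.finite

/-- Unextendible families in `ℂ² ⊗ ℂⁿ` are complete. -/
theorem span_eq_top_of_finrank_left_le_two (h : IsUnextendible a b) (hA : finrank ℂ A ≤ 2) :
    Submodule.span ℂ (Set.range fun i => a i ⊗ₜ[ℂ] b i) = ⊤ := by
  set T := Submodule.span ℂ (Set.range fun i => a i ⊗ₜ[ℂ] b i)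
  have key : ∀ i x, ⟪a i, x⟫_ℂ = 0 → x ⊗ₜ[ℂ] b i ∈ T := by
    intro i x hx
    by_cases hx0 : x = 0
    · simp [hx0]
    have hprop : ∀ j, ⟪a j, a i⟫_ℂ = 0 → ∃ c : ℂ, c ≠ 0 ∧ a j = c • x := by
      intro j hj
      have hr : finrank ℂ (Submodule.span ℂ {a i})ᗮ ≤ 1 := by
        have := (Submodule.span ℂ {a i}).finrank_add_finrank_orthogonal
        rw [finrank_span_singleton (h.left_ne_zero i)] at this
        omega
      have hxm : x ∈ (Submodule.span ℂ {a i})ᗮ :=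
        Submodule.mem_orthogonal_singleton_iff_inner_right.2 hx
      have hjm : a j ∈ (Submodule.span ℂ {a i})ᗮ :=
        Submodule.mem_orthogonal_singleton_iff_inner_left.2 hj
      have hle : Submodule.span ℂ {x} ≤ (Submodule.span ℂ {a i})ᗮ := by
        rwa [Submodule.span_singleton_le_iff_mem]
      have heq := Submodule.eq_of_le_of_finrank_le hle (by rwa [finrank_span_singleton hx0])
      rw [← heq] at hjm
      obtain ⟨c, hc⟩ := Submodule.mem_span_singleton.1 hjm
      refine ⟨c, ?_, hc.symm⟩
      rintro rfl
      exact h.left_ne_zero j (by rw [← hc, zero_smul])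
    -- The `a j` orthogonal to `a i` are multiples of `x`, so `x ⊗ D` lies in `T`. It remains to see
    -- `b i ∈ D`: otherwise `x` times the part of `b i` orthogonal to `D` would extend the family.
    let D := Submodule.span ℂ (b '' {j | ⟪a j, a i⟫_ℂ = 0})
    have hbD : b i ∈ D := by
      have hv := D.sub_starProjection_mem_orthogonal (b i)
      by_contra hcon
      have hv0 : b i - D.starProjection (b i) ≠ 0 := fun h0 =>
        hcon (by rw [sub_eq_zero.1 h0]; exact Submodule.starProjection_apply_mem _ _)
      obtain ⟨j, hj, hj'⟩ := h.unextendible x _ hx0 hv0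
      have hji : ⟪a j, a i⟫_ℂ ≠ 0 := fun h0 =>
        hj' (hv _ (Submodule.subset_span ⟨j, h0, rfl⟩))
      have hne : j ≠ i := by rintro rfl; exact hj hx
      refine hj' ?_
      rw [inner_sub_right, (h.orthogonal j i hne).resolve_left hji, zero_sub, neg_eq_zero]
      refine Submodule.inner_left_of_mem_orthogonal (Submodule.starProjection_apply_mem D _) ?_
      rw [Submodule.mem_orthogonal]
      intro u hu
      induction hu using Submodule.span_induction with
      | mem u hu =>
        obtain ⟨k, hk, rfl⟩ := hu
        obtain ⟨c, hc, hck⟩ := hprop k hk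
        have hkj : k ≠ j := by rintro rfl; exact hji hk
        refine (h.orthogonal k j hkj).resolve_left ?_
        rw [hck, inner_smul_left]
        refine mul_ne_zero (by simpa using hc) fun h0 => hj (inner_eq_zero_symm.1 h0)
      | zero => simp
      | add u u' _ _ h h' => rw [inner_add_left, h, h', add_zero]
      | smul c u _ h => rw [inner_smul_left, h, mul_zero]
    have hmap : D ≤ T.comap (TensorProduct.mk ℂ A B x) := by
      refine Submodule.span_le.2 ?_
      rintro _ ⟨j, hj, rfl⟩
      obtain ⟨c, hc, hcj⟩ := hprop j hj
      have hmem : a j ⊗ₜ[ℂ] b j ∈ T := Submodule.subset_span ⟨j, rfl⟩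
      rw [hcj, ← TensorProduct.smul_tmul'] at hmem
      exact (Submodule.smul_mem_iff T hc).1 hmem
    exact hmap hbD
  have key2 : ∀ i x, x ⊗ₜ[ℂ] b i ∈ T := by
    intro i x
    have h1 := key i (x - ⟪a i, x⟫_ℂ • a i) (by
      simp [inner_self_eq_norm_sq_to_K, h.norm_left])
    have h2 : a i ⊗ₜ[ℂ] b i ∈ T := Submodule.subset_span ⟨i, rfl⟩
    rw [TensorProduct.sub_tmul, ← TensorProduct.smul_tmul'] at h1
    simpa using T.add_mem h1 (T.smul_mem ⟪a i, x⟫_ℂ h2)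
  rw [eq_top_iff, ← TensorProduct.span_tmul_eq_top, Submodule.span_le]
  rintro _ ⟨x, y, rfl⟩
  by_cases hx : x = 0
  · simp [hx]
  have hb : Submodule.span ℂ (Set.range b) = ⊤ := by
    by_contra hne
    obtain ⟨y, hy, hy0⟩ := Submodule.exists_mem_ne_zero_of_ne_bot
      (fun h' => hne (Submodule.orthogonal_eq_bot_iff.1 h'))
    obtain ⟨i, -, hi⟩ := h.unextendible x y hx hy0
    exact hi (hy _ (Submodule.subset_span ⟨i, rfl⟩))
  have hmap : Submodule.span ℂ (Set.range b) ≤ T.comap (TensorProduct.mk ℂ A B x) := by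
    refine Submodule.span_le.2 ?_
    rintro _ ⟨i, rfl⟩
    exact key2 i x
  exact hmap (hb ▸ Submodule.mem_top)

theorem card_of_span_eq_top (h : IsUnextendible a b)
    (hT : Submodule.span ℂ (Set.range fun i => a i ⊗ₜ[ℂ] b i) = ⊤) :
    Nat.card ι = finrank ℂ A * finrank ℂ B := by
  have := h.finite
  have := Fintype.ofFinite ι
  have h1 := finrank_span_eq_card h.orthonormal.linearIndependent
  rw [hT, finrank_top, finrank_tensorProduct] at h1
  rw [Nat.card_eq_fintype_card, h1]

/-- Positivity of the partial transpose of the projection to the complement of the family, in the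
form of a statement on its kernel. -/
theorem inner_projection_eq_zero (h : IsUnextendible a b) {β : A} {c : B}
    (h0 : (Submodule.span ℂ (Set.range fun i => a i ⊗ₜ[ℂ] b i))ᗮ.starProjection
      (β ⊗ₜ[ℂ] c) = 0) (α : A) (y : B) :
    ⟪(Submodule.span ℂ (Set.range fun i => a i ⊗ₜ[ℂ] b i))ᗮ.starProjection (β ⊗ₜ[ℂ] y),
      (Submodule.span ℂ (Set.range fun i => a i ⊗ₜ[ℂ] b i))ᗮ.starProjection
        (α ⊗ₜ[ℂ] c)⟫_ℂ = 0 := by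
  have := h.finite
  have := Fintype.ofFinite ι
  -- Orthogonality holds factor by factor, so applying `J` to the left vectors keeps the family
  -- orthonormal. In the Gram formula this exchanges `α` and `β`, which is the partial transpose.
  obtain ⟨J, hJ⟩ := exists_antiunitary A
  have hJo : Orthonormal ℂ fun i => J (a i) ⊗ₜ[ℂ] b i := by
    classical
    have ho := orthonormal_iff_ite.1 h.orthonormal
    simp only [TensorProduct.inner_tmul] at ho
    refine orthonormal_iff_ite.2 fun i j => ?_
    rw [TensorProduct.inner_tmul, hJ, ← ho i j]
    by_cases hij : i = j
    · rw [hij]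
    · rcases h.orthogonal i j hij with h' | h'
      · rw [h', inner_eq_zero_symm.1 h']
      · rw [h', mul_zero, mul_zero]
  have key : ∀ α β y c,
      ⟪(Submodule.span ℂ (Set.range fun i => a i ⊗ₜ[ℂ] b i))ᗮ.starProjection
        (β ⊗ₜ[ℂ] y), (Submodule.span ℂ (Set.range fun i =>
          a i ⊗ₜ[ℂ] b i))ᗮ.starProjection (α ⊗ₜ[ℂ] c)⟫_ℂ =
      ⟪(Submodule.span ℂ (Set.range fun i => J (a i) ⊗ₜ[ℂ] b i))ᗮ.starProjection
        (J α ⊗ₜ[ℂ] y), (Submodule.span ℂ (Set.range fun i =>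
          J (a i) ⊗ₜ[ℂ] b i))ᗮ.starProjection (J β ⊗ₜ[ℂ] c)⟫_ℂ := by
    intro α β y c
    rw [h.orthonormal.inner_projection_orthogonal_span, hJo.inner_projection_orthogonal_span]
    simp only [TensorProduct.inner_tmul, hJ]
    congr 1
    exact Finset.sum_congr rfl fun i _ => by ring
  rw [key]
  have h1 := key β β c c
  rw [h0, inner_zero_left, eq_comm] at h1
  rw [inner_self_eq_zero (𝕜 := ℂ) (E := A ⊗[ℂ] B).1 h1, inner_zero_right]

/-- Incomplete unextendible families in `ℂ³ ⊗ ℂ³` have five members. -/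
theorem card_eq_five (h : IsUnextendible a b) (hA : finrank ℂ A = 3) (hB : finrank ℂ B = 3)
    (hT : Submodule.span ℂ (Set.range fun i => a i ⊗ₜ[ℂ] b i) ≠ ⊤) : Nat.card ι = 5 := by
  classical
  have := h.finite
  have := Fintype.ofFinite ι
  have hcard := finrank_span_eq_card h.orthonormal.linearIndependent
  rw [Nat.card_eq_fintype_card]
  -- At most four vectors split into two groups of at most two; in dimension 3 some `x` is
  -- orthogonal to one group's left vectors and some `y` to the other's right vectors.
  have hge : 5 ≤ Fintype.card ι := by
    by_contra! hlt
    obtain ⟨s, hs⟩ : ∃ s : Finset ι, s.card = Fintype.card ι / 2 := by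
      obtain ⟨s, -, hs⟩ := Finset.exists_subset_card_eq (s := (Finset.univ : Finset ι))
        (n := Fintype.card ι / 2) (Nat.div_le_self _ _)
      exact ⟨s, hs⟩
    have hsc := s.card_compl
    obtain ⟨x, hx, hxs⟩ := exists_ne_zero_forall_inner_eq_zero a s (by omega)
    obtain ⟨y, hy, hys⟩ := exists_ne_zero_forall_inner_eq_zero b sᶜ (by omega)
    obtain ⟨i, hi, hi'⟩ := h.unextendible x y hx hy
    by_cases his : i ∈ s
    · exact hi (hxs i his)
    · exact hi' (hys i (Finset.mem_compl.2 his))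
  set T := Submodule.span ℂ (Set.range fun i => a i ⊗ₜ[ℂ] b i)
  by_contra hne
  have hsum := T.finrank_add_finrank_orthogonal
  rw [finrank_tensorProduct, hA, hB] at hsum
  have : Nontrivial Tᗮ := Submodule.nontrivial_iff_ne_bot.2
    fun h' => hT (Submodule.orthogonal_eq_bot_iff.1 h')
  -- At least six orthonormal vectors in dimension nine.
  have hW : finrank ℂ Tᗮ ≤ 3 := by omega
  let Z : A →ₗ[ℂ] B →ₗ[ℂ] Tᗮ :=
    (TensorProduct.mk ℂ A B).compr₂ (Tᗮ.orthogonalProjectionOnto : A ⊗[ℂ] B →ₗ[ℂ] Tᗮ)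
  obtain ⟨w, hw, y, hy, hwy⟩ := exists_contraction (W := Tᗮ) Z
    (fun β c h0 α b => h.inner_projection_eq_zero (congrArg Subtype.val h0) α b) hA hB hW
  obtain ⟨x, hx⟩ := exists_eq_tmul_of_inner_eq_zero hy (w := (w : A ⊗[ℂ] B)) fun α b hb => by
    rw [← Submodule.inner_orthogonalProjectionOnto_eq_of_mem_left]
    exact hwy α b hb
  have hx0 : x ≠ 0 := by
    rintro rfl
    exact hw (Subtype.ext (by rw [hx, TensorProduct.zero_tmul]; rfl))
  obtain ⟨i, hi, hi'⟩ := h.unextendible x y hx0 hy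
  have := w.2 _ (Submodule.subset_span ⟨i, rfl⟩)
  rw [hx, TensorProduct.inner_tmul] at this
  exact mul_ne_zero hi hi' this

end IsUnextendible

end ProductFamilies

/-! ### Splitting a local space by an orthogonality-preserving operator -/

section Splitting

variable {ι A B : Type*}
  [NormedAddCommGroup A] [InnerProductSpace ℂ A]
  [NormedAddCommGroup B] [InnerProductSpace ℂ B]

theorem span_tmul_eq_top_of_forall_mem {T : Submodule ℂ (A ⊗[ℂ] B)} (V : Submodule ℂ B)
    [V.HasOrthogonalProjection] (h : ∀ x, ∀ y ∈ V, x ⊗ₜ[ℂ] y ∈ T)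
    (h' : ∀ x, ∀ y ∈ Vᗮ, x ⊗ₜ[ℂ] y ∈ T) : T = ⊤ := by
  rw [eq_top_iff, ← TensorProduct.span_tmul_eq_top, Submodule.span_le]
  rintro _ ⟨x, y, rfl⟩
  obtain ⟨y₁, h₁, y₂, h₂, rfl⟩ := V.exists_add_mem_mem_orthogonal y
  rw [TensorProduct.tmul_add]
  exact T.add_mem (h x y₁ h₁) (h' x y₂ h₂)

namespace IsUnextendible

variable {a : ι → A} {b : ι → B}

theorem tmul_mem_span_of_restrict {V : Submodule ℂ B}
    (h : Submodule.span ℂ (Set.range fun i : {i // b i ∈ V} =>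
      a i ⊗ₜ[ℂ] (⟨b i, i.2⟩ : V)) = ⊤) (x : A) {y : B} (hy : y ∈ V) :
    x ⊗ₜ[ℂ] y ∈ Submodule.span ℂ (Set.range fun i : {i // b i ∈ V} => a i ⊗ₜ[ℂ] b i) := by
  have h1 : x ⊗ₜ[ℂ] (⟨y, hy⟩ : V) ∈ Submodule.span ℂ (Set.range fun i : {i // b i ∈ V} =>
      a i ⊗ₜ[ℂ] (⟨b i, i.2⟩ : V)) := h ▸ Submodule.mem_top
  have h2 := Submodule.mem_map_of_mem (f := LinearMap.lTensor A V.subtype) h1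
  rw [Submodule.map_span, ← Set.range_comp] at h2
  exact h2

variable [FiniteDimensional ℂ B]

/-- A nontrivial orthogonality-preserving operator splits the local space of its party. -/
theorem exists_splitting (h : IsUnextendible a b) (N : B →ₗ[ℂ] B) (hs : N.IsSymmetric)
    (hns : ∀ c : ℂ, N ≠ c • LinearMap.id)
    (hN : ∀ i j, i ≠ j → ⟪a i, a j⟫_ℂ = 0 ∨ ⟪b i, N (b j)⟫_ℂ = 0) :
    ∃ V : Submodule ℂ B, V ≠ ⊥ ∧ V ≠ ⊤ ∧ ∀ i, b i ∈ V ∨ b i ∈ Vᗮ := by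
  have : Nontrivial B := by
    by_contra hB
    rw [not_nontrivial_iff_subsingleton] at hB
    exact hns 0 (LinearMap.ext fun x => Subsingleton.elim _ _)
  obtain ⟨μ, hμ⟩ := Module.End.exists_eigenvalue N
  refine ⟨Module.End.eigenspace N μ, hμ, fun ht => hns μ (LinearMap.ext fun x => ?_), fun i => ?_⟩
  · exact Module.End.mem_eigenspace_iff.1 (ht ▸ Submodule.mem_top : x ∈ Module.End.eigenspace N μ)
  · have hi := h.apply_eq_smul N hN i
    by_cases he : ⟪b i, N (b i)⟫_ℂ = μ
    · exact Or.inl (Module.End.mem_eigenspace_iff.2 (he ▸ hi))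
    · refine Or.inr ?_
      intro x hx
      exact hs.orthogonalFamily_eigenspaces (Ne.symm he) ⟨x, hx⟩
        ⟨b i, Module.End.mem_eigenspace_iff.2 hi⟩

theorem restrict_right_orthogonal (h : IsUnextendible a b) (V : Submodule ℂ B)
    (hV : ∀ i, b i ∈ V ∨ b i ∈ Vᗮ) :
    IsUnextendible (fun i : {i // b i ∈ Vᗮ} => a i)
      (fun i : {i // b i ∈ Vᗮ} => (⟨b i, i.2⟩ : ↥Vᗮ)) :=
  h.restrict_right Vᗮ fun i => by rw [V.orthogonal_orthogonal]; exact (hV i).symm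

theorem span_eq_top_of_restrict {V : Submodule ℂ B}
    (h : Submodule.span ℂ (Set.range fun i : {i // b i ∈ V} =>
      a i ⊗ₜ[ℂ] (⟨b i, i.2⟩ : V)) = ⊤)
    (h' : Submodule.span ℂ (Set.range fun i : {i // b i ∈ Vᗮ} =>
      a i ⊗ₜ[ℂ] (⟨b i, i.2⟩ : ↥Vᗮ)) = ⊤) :
    Submodule.span ℂ (Set.range fun i => a i ⊗ₜ[ℂ] b i) = ⊤ := by
  refine span_tmul_eq_top_of_forall_mem V (fun x y hy => ?_) (fun x y hy => ?_)
  · refine Submodule.span_mono ?_ (tmul_mem_span_of_restrict h x hy)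
    rintro _ ⟨i, rfl⟩
    exact ⟨i, rfl⟩
  · refine Submodule.span_mono ?_ (tmul_mem_span_of_restrict h' x hy)
    rintro _ ⟨i, rfl⟩
    exact ⟨i, rfl⟩

variable [FiniteDimensional ℂ A]

theorem span_eq_top_of_finrank_right_le_two (h : IsUnextendible a b) (hB : finrank ℂ B ≤ 2) :
    Submodule.span ℂ (Set.range fun i => a i ⊗ₜ[ℂ] b i) = ⊤ :=
  span_eq_top_swap (h.swap.span_eq_top_of_finrank_left_le_two hB)

/-- A splitting of a local space into parts of dimension at most two is only possible for complete
families. -/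
theorem span_eq_top_of_splitting (h : IsUnextendible a b) {V : Submodule ℂ B}
    (hV : ∀ i, b i ∈ V ∨ b i ∈ Vᗮ) (h1 : finrank ℂ V ≤ 2) (h2 : finrank ℂ Vᗮ ≤ 2) :
    Submodule.span ℂ (Set.range fun i => a i ⊗ₜ[ℂ] b i) = ⊤ :=
  span_eq_top_of_restrict ((h.restrict_right V hV).span_eq_top_of_finrank_right_le_two h1)
    ((h.restrict_right_orthogonal V hV).span_eq_top_of_finrank_right_le_two h2)

/-- A 2+2 split would force completeness; of the remaining 3+1 and 1+3 the larger part is taken as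
`V`. -/
theorem exists_splitting_three_one (h : IsUnextendible a b) (hB : finrank ℂ B = 4)
    (hT : Submodule.span ℂ (Set.range fun i => a i ⊗ₜ[ℂ] b i) ≠ ⊤)
    (N : B →ₗ[ℂ] B) (hs : N.IsSymmetric) (hns : ∀ c : ℂ, N ≠ c • LinearMap.id)
    (hN : ∀ i j, i ≠ j → ⟪a i, a j⟫_ℂ = 0 ∨ ⟪b i, N (b j)⟫_ℂ = 0) :
    ∃ V : Submodule ℂ B, finrank ℂ V = 3 ∧ ∀ i, b i ∈ V ∨ b i ∈ Vᗮ := by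
  obtain ⟨V, hbot, htop, hV⟩ := h.exists_splitting N hs hns hN
  have hsum := V.finrank_add_finrank_orthogonal
  have h1 : finrank ℂ V ≠ 0 := fun h0 => hbot (Submodule.finrank_eq_zero.1 h0)
  have h2 := Submodule.finrank_lt htop
  by_cases h3 : finrank ℂ V = 3
  · exact ⟨V, h3, hV⟩
  by_cases h4 : finrank ℂ V = 2
  · exact absurd (h.span_eq_top_of_splitting hV (by omega) (by omega)) hT
  · exact ⟨Vᗮ, by omega, fun i => by rw [V.orthogonal_orthogonal]; exact (hV i).symm⟩

/-- Any proper split of a three-dimensional space has both parts of dimension at most two. This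
rules out Alice as the first to measure nontrivially. -/
theorem span_eq_top_of_nontrivial_operator (h : IsUnextendible a b) (hB : finrank ℂ B = 3)
    (N : B →ₗ[ℂ] B) (hs : N.IsSymmetric) (hns : ∀ c : ℂ, N ≠ c • LinearMap.id)
    (hN : ∀ i j, i ≠ j → ⟪a i, a j⟫_ℂ = 0 ∨ ⟪b i, N (b j)⟫_ℂ = 0) :
    Submodule.span ℂ (Set.range fun i => a i ⊗ₜ[ℂ] b i) = ⊤ := by
  obtain ⟨V, hbot, htop, hV⟩ := h.exists_splitting N hs hns hN
  have hsum := V.finrank_add_finrank_orthogonal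
  have h1 : finrank ℂ V ≠ 0 := fun h0 => hbot (Submodule.finrank_eq_zero.1 h0)
  have h2 := Submodule.finrank_lt htop
  exact h.span_eq_top_of_splitting hV (by omega) (by omega)

end IsUnextendible

end Splitting

/-! ### From sets of states to families of local vectors -/

section UnextendibleProductBases

variable {HA HB : Type*}
  [NormedAddCommGroup HA] [InnerProductSpace ℂ HA]
  [NormedAddCommGroup HB] [InnerProductSpace ℂ HB]

theorem IsUPB.exists_isUnextendible {S : Set (HA ⊗[ℂ] HB)} (hS : IsUPB S) :
    ∃ (a : S → HA) (b : S → HB), (∀ s : S, (s : HA ⊗[ℂ] HB) = a s ⊗ₜ[ℂ] b s) ∧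
      IsUnextendible a b := by
  choose a _ b _ ha hb hab using fun s : S => hS.product s s.2
  refine ⟨a, b, hab, ha, hb, fun s t hst => ?_, fun x y hx hy => ?_⟩
  · have := hS.orthogonal s.2 t.2 (fun h => hst (Subtype.ext h))
    rw [hab s, hab t, TensorProduct.inner_tmul] at this
    exact mul_eq_zero.1 this
  · by_contra! hcon
    refine hS.unextendible (((‖x‖⁻¹ : ℂ) • x) ⊗ₜ[ℂ] ((‖y‖⁻¹ : ℂ) • y))
      ⟨_, Submodule.mem_top, _, Submodule.mem_top, norm_smul_inv_norm hx, norm_smul_inv_norm hy,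
        rfl⟩ ?_
    rw [Submodule.mem_orthogonal]
    intro z hz
    induction hz using Submodule.span_induction with
    | mem s hs =>
      have hs' : s = a ⟨s, hs⟩ ⊗ₜ[ℂ] b ⟨s, hs⟩ := hab ⟨s, hs⟩
      rw [hs', TensorProduct.inner_tmul, inner_smul_right, inner_smul_right]
      by_cases h : ⟪a ⟨s, hs⟩, x⟫_ℂ = 0
      · rw [h]; ring
      · rw [hcon _ h]; ring
    | zero => exact inner_zero_left _
    | add u u' _ _ h h' => rw [inner_add_left, h, h', add_zero]
    | smul c u _ h => rw [inner_smul_left, h, mul_zero]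

/-- The part of an unextendible product basis inside a subspace `HA ⊗ V`, when the remaining states
form a complete basis of `HA ⊗ Vᗮ`. -/
theorem IsUPB.isUPBIn_of_splitting [FiniteDimensional ℂ HB] {S : Set (HA ⊗[ℂ] HB)} (hS : IsUPB S)
    {a : S → HA} {b : S → HB} (hab : ∀ s : S, (s : HA ⊗[ℂ] HB) = a s ⊗ₜ[ℂ] b s) (h : IsUnextendible a b)
    (V : Submodule ℂ HB) (hV : ∀ s, b s ∈ V ∨ b s ∈ Vᗮ)
    (hfull : Submodule.span ℂ (Set.range fun i : {i // b i ∈ Vᗮ} =>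
      a i ⊗ₜ[ℂ] (⟨b i, i.2⟩ : ↥Vᗮ)) = ⊤) :
    IsUPBIn ⊤ V (Subtype.val '' {s : S | b s ∈ V}) where
  product := by
    rintro _ ⟨s, hs, rfl⟩
    exact ⟨a s, Submodule.mem_top, b s, hs, h.norm_left s, h.norm_right s, hab s⟩
  orthogonal := hS.orthogonal.mono (by rintro _ ⟨s, -, rfl⟩; exact s.2)
  incomplete := by
    refine lt_of_le_not_ge (Submodule.span_mono ?_) fun hle => ?_
    · rintro _ ⟨s, hs, rfl⟩
      exact ⟨a s, Submodule.mem_top, b s, hs, hab s⟩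
    · refine hS.incomplete.not_ge (le_top.trans_eq (Eq.symm ?_))
      refine span_tmul_eq_top_of_forall_mem V (fun x y hy => ?_) (fun x y hy => ?_)
      · refine Submodule.span_mono ?_ (hle (Submodule.subset_span
          ⟨x, Submodule.mem_top, y, hy, rfl⟩))
        rintro _ ⟨s, -, rfl⟩
        exact s.2
      · refine Submodule.span_mono ?_ (IsUnextendible.tmul_mem_span_of_restrict hfull x hy)
        rintro _ ⟨i, rfl⟩
        simp only [← hab]
        exact i.1.2
  unextendible := by
    rintro _ ⟨x, -, y, hy, hx1, hy1, rfl⟩ hmem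
    obtain ⟨s, hs, hs'⟩ := h.unextendible x y (norm_ne_zero_iff.1 (by rw [hx1]; exact one_ne_zero))
      (norm_ne_zero_iff.1 (by rw [hy1]; exact one_ne_zero))
    have hsV : b s ∈ V := (hV s).resolve_right fun hb =>
      hs' (Submodule.inner_left_of_mem_orthogonal hy hb)
    have h0 := hmem s (Submodule.subset_span ⟨s, hsV, rfl⟩)
    rw [hab s, TensorProduct.inner_tmul] at h0
    exact mul_ne_zero hs hs' h0

end UnextendibleProductBases

/-! ### LOCC protocols: the first nontrivial measurement -/

section Protocols

variable {ι HA HB : Type*}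
  [NormedAddCommGroup HA] [InnerProductSpace ℂ HA] [FiniteDimensional ℂ HA]
  [NormedAddCommGroup HB] [InnerProductSpace ℂ HB] [FiniteDimensional ℂ HB]

theorem LOCC.id_mem_stageOps (P : LOCC HA HB) : LinearMap.id ∈ P.stageOps := by
  cases P <;> simp [LOCC.stageOps]

theorem inner_eq_of_adjoint_comp_self {H : Type*} [NormedAddCommGroup H] [InnerProductSpace ℂ H]
    [FiniteDimensional ℂ H] {u : H →ₗ[ℂ] H} {p : ℂ}
    (hu : LinearMap.adjoint u ∘ₗ u = p • LinearMap.id) (x y : H) :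
    ⟪u x, u y⟫_ℂ = p * ⟪x, y⟫_ℂ := by
  have := LinearMap.congr_fun hu y
  rw [← LinearMap.adjoint_inner_right, ← LinearMap.comp_apply, this]
  simp [inner_smul_right]

/-- If a protocol that preserves the orthogonality of a family of product vectors eliminates some
but not all of them, then some party has a nontrivial orthogonality-preserving operator. The
vectors are first acted upon by multiples `u`, `v` of unitaries. -/
theorem LOCC.exists_nontrivial_operator {a : ι → HA} {b : ι → HB} (ha : ∀ i, a i ≠ 0)
    (hb : ∀ i, b i ≠ 0) (P : LOCC HA HB) (u : HA →ₗ[ℂ] HA) (v : HB →ₗ[ℂ] HB) {p q : ℂ}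
    (hp : p ≠ 0) (hq : q ≠ 0) (hu : LinearMap.adjoint u ∘ₗ u = p • LinearMap.id)
    (hv : LinearMap.adjoint v ∘ₗ v = q • LinearMap.id)
    (hop : ∀ L ∈ P.stageOps, ∀ i j, i ≠ j →
      ⟪L (u (a i) ⊗ₜ[ℂ] v (b i)), L (u (a j) ⊗ₜ[ℂ] v (b j))⟫_ℂ = 0)
    (hel : ∃ L ∈ P.stageOps, (∃ i, L (u (a i) ⊗ₜ[ℂ] v (b i)) = 0) ∧
      ∃ i, L (u (a i) ⊗ₜ[ℂ] v (b i)) ≠ 0) :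
    (∃ M : HA →ₗ[ℂ] HA, M.IsSymmetric ∧ (∀ c : ℂ, M ≠ c • LinearMap.id) ∧
      ∀ i j, i ≠ j → ⟪b i, b j⟫_ℂ = 0 ∨ ⟪a i, M (a j)⟫_ℂ = 0) ∨
    (∃ N : HB →ₗ[ℂ] HB, N.IsSymmetric ∧ (∀ c : ℂ, N ≠ c • LinearMap.id) ∧
      ∀ i j, i ≠ j → ⟪a i, a j⟫_ℂ = 0 ∨ ⟪b i, N (b j)⟫_ℂ = 0) := by
  have hid : ∀ i, u (a i) ⊗ₜ[ℂ] v (b i) ≠ 0 := by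
    intro i h0
    have h1 : ⟪u (a i) ⊗ₜ[ℂ] v (b i), u (a i) ⊗ₜ[ℂ] v (b i)⟫_ℂ = 0 := by
      rw [h0, inner_zero_left]
    rw [TensorProduct.inner_tmul, inner_eq_of_adjoint_comp_self hu,
      inner_eq_of_adjoint_comp_self hv] at h1
    exact mul_ne_zero (mul_ne_zero hp (inner_self_ne_zero.2 (ha i)))
      (mul_ne_zero hq (inner_self_ne_zero.2 (hb i))) h1
  induction P generalizing u v p q with
  | halt =>
    obtain ⟨L, hL, ⟨i, hi⟩, -⟩ := hel
    simp only [LOCC.stageOps, Set.mem_singleton_iff] at hL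
    subst hL
    exact absurd hi (hid i)
  | alice k K hK next ih =>
    obtain ⟨L, hL, ⟨i, hi⟩, j, hj⟩ := hel
    rcases hL with rfl | ⟨m, L, hL, rfl⟩
    · exact absurd hi (hid i)
    have hop' : ∀ L ∈ (next m).stageOps, ∀ i j, i ≠ j →
        ⟪L ((K m ∘ₗ u) (a i) ⊗ₜ[ℂ] v (b i)), L ((K m ∘ₗ u) (a j) ⊗ₜ[ℂ] v (b j))⟫_ℂ = 0 :=
      fun L hL i j hij => hop _ (Or.inr ⟨m, L, hL, rfl⟩) i j hij
    -- A scalar round is absorbed into `u`, with `c ≠ 0` because state `j` survives. A non-scalar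
    -- one gives the operator: Bob's `v` only rescales his inner products by `q ≠ 0`.
    by_cases hsc : ∃ c : ℂ, LinearMap.adjoint (K m ∘ₗ u) ∘ₗ (K m ∘ₗ u) = c • LinearMap.id
    · obtain ⟨c, hc⟩ := hsc
      have hc0 : c ≠ 0 := by
        rintro rfl
        apply hj
        have h0 : (K m ∘ₗ u) (a j) = 0 := by
          rw [← inner_self_eq_zero (𝕜 := ℂ), inner_eq_of_adjoint_comp_self hc, zero_mul]
        rw [LinearMap.comp_apply] at h0
        rw [LinearMap.comp_apply, TensorProduct.map_tmul, h0, TensorProduct.zero_tmul, map_zero]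
      refine ih m (K m ∘ₗ u) v hc0 hq hc hv hop' ⟨L, hL, ⟨i, hi⟩, j, hj⟩ fun i h0 => ?_
      have h1 : ⟪(K m ∘ₗ u) (a i) ⊗ₜ[ℂ] v (b i), (K m ∘ₗ u) (a i) ⊗ₜ[ℂ] v (b i)⟫_ℂ = 0 := by
        rw [h0, inner_zero_left]
      rw [TensorProduct.inner_tmul, inner_eq_of_adjoint_comp_self hc,
        inner_eq_of_adjoint_comp_self hv] at h1
      exact mul_ne_zero (mul_ne_zero hc0 (inner_self_ne_zero.2 (ha i)))
        (mul_ne_zero hq (inner_self_ne_zero.2 (hb i))) h1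
    · push Not at hsc
      refine Or.inl ⟨_, LinearMap.isSymmetric_adjoint_mul_self (K m ∘ₗ u), hsc, fun i j hij => ?_⟩
      have h1 := hop' _ (next m).id_mem_stageOps i j hij
      rw [LinearMap.id_apply, LinearMap.id_apply, TensorProduct.inner_tmul,
        inner_eq_of_adjoint_comp_self hv, ← LinearMap.adjoint_inner_right] at h1
      exact (mul_eq_zero.1 h1).symm.imp_left fun h => (mul_eq_zero.1 h).resolve_left hq
  | bob k K hK next ih =>
    obtain ⟨L, hL, ⟨i, hi⟩, j, hj⟩ := hel
    rcases hL with rfl | ⟨m, L, hL, rfl⟩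
    · exact absurd hi (hid i)
    have hop' : ∀ L ∈ (next m).stageOps, ∀ i j, i ≠ j →
        ⟪L (u (a i) ⊗ₜ[ℂ] (K m ∘ₗ v) (b i)), L (u (a j) ⊗ₜ[ℂ] (K m ∘ₗ v) (b j))⟫_ℂ = 0 :=
      fun L hL i j hij => hop _ (Or.inr ⟨m, L, hL, rfl⟩) i j hij
    by_cases hsc : ∃ c : ℂ, LinearMap.adjoint (K m ∘ₗ v) ∘ₗ (K m ∘ₗ v) = c • LinearMap.id
    · obtain ⟨c, hc⟩ := hsc
      have hc0 : c ≠ 0 := by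
        rintro rfl
        apply hj
        have h0 : (K m ∘ₗ v) (b j) = 0 := by
          rw [← inner_self_eq_zero (𝕜 := ℂ), inner_eq_of_adjoint_comp_self hc, zero_mul]
        rw [LinearMap.comp_apply] at h0
        rw [LinearMap.comp_apply, TensorProduct.map_tmul, h0, TensorProduct.tmul_zero, map_zero]
      refine ih m u (K m ∘ₗ v) hp hc0 hu hc hop' ⟨L, hL, ⟨i, hi⟩, j, hj⟩ fun i h0 => ?_
      have h1 : ⟪u (a i) ⊗ₜ[ℂ] (K m ∘ₗ v) (b i), u (a i) ⊗ₜ[ℂ] (K m ∘ₗ v) (b i)⟫_ℂ = 0 := by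
        rw [h0, inner_zero_left]
      rw [TensorProduct.inner_tmul, inner_eq_of_adjoint_comp_self hc,
        inner_eq_of_adjoint_comp_self hu] at h1
      exact mul_ne_zero (mul_ne_zero hp (inner_self_ne_zero.2 (ha i)))
        (mul_ne_zero hc0 (inner_self_ne_zero.2 (hb i))) h1
    · push Not at hsc
      refine Or.inr ⟨_, LinearMap.isSymmetric_adjoint_mul_self (K m ∘ₗ v), hsc, fun i j hij => ?_⟩
      have h1 := hop' _ (next m).id_mem_stageOps i j hij
      rw [LinearMap.id_apply, LinearMap.id_apply, TensorProduct.inner_tmul,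
        inner_eq_of_adjoint_comp_self hu, ← LinearMap.adjoint_inner_right] at h1
      exact (mul_eq_zero.1 h1).imp_left fun h => (mul_eq_zero.1 h).resolve_left hp

/-- Bob's projective measurement on a subspace and its complement eliminates the states in the
complement, if all states are in one of the two. -/
theorem canEliminate_of_splitting {S : Set (HA ⊗[ℂ] HB)} {a : S → HA} {b : S → HB}
    (hab : ∀ s : S, (s : HA ⊗[ℂ] HB) = a s ⊗ₜ[ℂ] b s) (ha : ∀ s, a s ≠ 0) (hb : ∀ s, b s ≠ 0)
    (hS : S.Pairwise fun s t => ⟪s, t⟫_ℂ = 0) (V : Submodule ℂ HB)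
    (hV : ∀ s, b s ∈ V ∨ b s ∈ Vᗮ) (hne : ∃ s, b s ∈ V) :
    CanEliminate S (Subtype.val '' {s : S | b s ∈ Vᗮ}) := by
  let K : Fin 2 → (HB →ₗ[ℂ] HB) := ![V.starProjection, Vᗮ.starProjection]
  have hadj : ∀ (W : Submodule ℂ HB), LinearMap.adjoint (W.starProjection : HB →ₗ[ℂ] HB) ∘ₗ
      (W.starProjection : HB →ₗ[ℂ] HB) = (W.starProjection : HB →ₗ[ℂ] HB) := by
    intro W
    refine LinearMap.ext fun x => ext_inner_left ℂ fun y => ?_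
    rw [LinearMap.comp_apply, LinearMap.adjoint_inner_right]
    simp only [ContinuousLinearMap.coe_coe]
    rw [Submodule.inner_starProjection_left_eq_right, Submodule.starProjection_eq_self_iff.2
      (Submodule.starProjection_apply_mem _ x)]
  have hK : IsMeasurement K := by
    unfold IsMeasurement
    rw [Fin.sum_univ_two]
    simp only [K, Matrix.cons_val_zero, Matrix.cons_val_one, hadj]
    ext x
    exact V.starProjection_add_starProjection_orthogonal x
  have hself : ∀ (W : Submodule ℂ HB) x, x ∈ W → W.starProjection x = x :=
    fun W x => Submodule.starProjection_eq_self_iff.2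
  have hzero : ∀ (W : Submodule ℂ HB) x, x ∈ Wᗮ → W.starProjection x = 0 :=
    fun W x => (Submodule.starProjection_apply_eq_zero_iff W).2
  have hcase : ∀ m s, K m (b s) = b s ∨ K m (b s) = 0 := by
    intro m s
    fin_cases m
    · exact (hV s).imp (hself V _) (hzero V _)
    · exact (hV s).symm.imp (hself Vᗮ _) fun h => hzero Vᗮ _ (by rwa [V.orthogonal_orthogonal])
  have happ : ∀ m (s : S), TensorProduct.map LinearMap.id (K m) (s : HA ⊗[ℂ] HB) =
      a s ⊗ₜ[ℂ] K m (b s) := fun m s => by rw [hab s, TensorProduct.map_tmul, LinearMap.id_apply]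
  refine ⟨LOCC.bob 2 K hK fun _ => LOCC.halt, ?_, TensorProduct.map LinearMap.id (K 0),
    Or.inr ⟨0, LinearMap.id, rfl, rfl⟩, ?_, ?_⟩
  · rintro L hL s hs t ht hst
    rcases hL with rfl | ⟨m, L', hL', rfl⟩
    · exact hS hs ht hst
    · simp only [LOCC.stageOps, Set.mem_singleton_iff] at hL'
      subst hL'
      simp only [LinearMap.id_comp]
      rw [happ m ⟨s, hs⟩, happ m ⟨t, ht⟩]
      rcases hcase m ⟨s, hs⟩ with h | h
      · rcases hcase m ⟨t, ht⟩ with h' | h'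
        · rw [h, h', ← hab, ← hab]
          exact hS hs ht hst
        · rw [h', TensorProduct.tmul_zero, inner_zero_right]
      · rw [h, TensorProduct.tmul_zero, inner_zero_left]
  · ext s
    constructor
    · rintro ⟨s, hs, rfl⟩
      refine ⟨s.2, ?_⟩
      have h0 : K 0 (b s) = 0 := hzero V _ hs
      rw [happ, h0, TensorProduct.tmul_zero]
    · rintro ⟨hs, h0⟩
      refine ⟨⟨s, hs⟩, (hV _).resolve_left fun hbV => ?_, rfl⟩
      have h1 : K 0 (b ⟨s, hs⟩) = b ⟨s, hs⟩ := hself V _ hbV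
      rw [happ 0 ⟨s, hs⟩, h1, ← norm_eq_zero, TensorProduct.norm_tmul] at h0
      exact mul_ne_zero (norm_ne_zero_iff.2 (ha _)) (norm_ne_zero_iff.2 (hb _)) h0
  · obtain ⟨s, hs⟩ := hne
    refine ⟨s, s.2, ?_⟩
    have h1 : K 0 (b s) = b s := hself V _ hs
    rw [happ, h1, ← norm_ne_zero_iff, TensorProduct.norm_tmul]
    exact mul_ne_zero (norm_ne_zero_iff.2 (ha _)) (norm_ne_zero_iff.2 (hb _))

end Protocols

/-! ### The count 5 + 3 -/

theorem proposition6
    (S : Set (EuclideanSpace ℂ (Fin 3) ⊗[ℂ] EuclideanSpace ℂ (Fin 4)))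
    (hS : IsReducibleUPB S) :
    S.ncard = 8 ∧
    ∃ (A : Submodule ℂ (EuclideanSpace ℂ (Fin 3))) (B : Submodule ℂ (EuclideanSpace ℂ (Fin 4)))
      (T U : Set (EuclideanSpace ℂ (Fin 3) ⊗[ℂ] EuclideanSpace ℂ (Fin 4))),
      Module.finrank ℂ A = 3 ∧ Module.finrank ℂ B = 3 ∧
      S = T ∪ U ∧ Disjoint T U ∧
      IsUPBIn A B T ∧ T.ncard = 5 ∧
      U.ncard = 3 ∧ CanEliminate S U := by
  obtain ⟨hupb, U₀, ⟨s₀, hs₀⟩, P, hP, L, hL, rfl, t₀, ht₀, hLt₀⟩ := hS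
  obtain ⟨a, b, hab, h⟩ := hupb.exists_isUnextendible
  have hA3 : finrank ℂ (EuclideanSpace ℂ (Fin 3)) = 3 := by simp
  have hB4 : finrank ℂ (EuclideanSpace ℂ (Fin 4)) = 4 := by simp
  have hT : Submodule.span ℂ (Set.range fun i => a i ⊗ₜ[ℂ] b i) ≠ ⊤ := by
    intro hT
    refine hupb.incomplete.not_ge (le_top.trans_eq ?_)
    rw [← hT]
    congr 1
    simp only [← hab, Subtype.range_coe]
  have hid {H : Type} [NormedAddCommGroup H] [InnerProductSpace ℂ H] [FiniteDimensional ℂ H] :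
      LinearMap.adjoint (LinearMap.id : H →ₗ[ℂ] H) ∘ₗ LinearMap.id =
        (1 : ℂ) • (LinearMap.id : H →ₗ[ℂ] H) := by
    simp
  obtain ⟨V, hV3, hV⟩ : ∃ V : Submodule ℂ (EuclideanSpace ℂ (Fin 4)), finrank ℂ V = 3 ∧
      ∀ i, b i ∈ V ∨ b i ∈ Vᗮ := by
    rcases P.exists_nontrivial_operator h.left_ne_zero h.right_ne_zero LinearMap.id LinearMap.id
      one_ne_zero one_ne_zero hid hid
      (fun L hL i j hij => by
        simp only [LinearMap.id_apply, ← hab]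
        exact hP L hL i.2 j.2 fun h => hij (Subtype.ext h))
      ⟨L, hL, ⟨⟨s₀, hs₀.1⟩, by simpa only [LinearMap.id_apply, ← hab] using hs₀.2⟩,
        ⟨t₀, ht₀⟩, by simpa only [LinearMap.id_apply, ← hab] using hLt₀⟩ with
      ⟨M, hM, hns, hor⟩ | ⟨N, hN, hns, hor⟩
    -- A nontrivial operator on Alice's side would make `S` complete.
    · exact absurd (IsUnextendible.span_eq_top_swap
        (h.swap.span_eq_top_of_nontrivial_operator hA3 M hM hns hor)) hT
    · exact h.exists_splitting_three_one hB4 hT N hN hns hor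
  have hsum := V.finrank_add_finrank_orthogonal
  have hVo : finrank ℂ Vᗮ = 1 := by omega
  have hr := h.restrict_right V hV
  have hro := h.restrict_right_orthogonal V hV
  have hfull := hro.span_eq_top_of_finrank_right_le_two (by omega)
  have hcU := hro.card_of_span_eq_top hfull
  rw [hA3, hVo] at hcU
  -- The part in `V` is incomplete, since the part in `Vᗮ` is complete and `S` is not.
  have hcT := hr.card_eq_five hA3 hV3 fun hr' =>
    hT (IsUnextendible.span_eq_top_of_restrict hr' hfull)
  have hTc : (Subtype.val '' {s : S | b s ∈ V}).ncard = 5 := by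
    rw [Set.ncard_image_of_injective _ Subtype.val_injective]
    exact hcT
  have hUc : (Subtype.val '' {s : S | b s ∈ Vᗮ}).ncard = 3 := by
    rw [Set.ncard_image_of_injective _ Subtype.val_injective]
    exact hcU
  have hunion : S = Subtype.val '' {s : S | b s ∈ V} ∪ Subtype.val '' {s : S | b s ∈ Vᗮ} := by
    rw [← Set.image_union]
    ext s
    constructor
    · exact fun hs => ⟨⟨s, hs⟩, hV _, rfl⟩
    · rintro ⟨s, -, rfl⟩
      exact s.2
  have hdisj : Disjoint (Subtype.val '' {s : S | b s ∈ V}) (Subtype.val '' {s : S | b s ∈ Vᗮ}) := by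
    rw [Set.disjoint_image_iff Subtype.val_injective, Set.disjoint_left]
    exact fun s hs hs' => h.right_ne_zero s (inner_self_eq_zero.1 (hs' _ hs))
  have hne : ∃ s, b s ∈ V := by
    have hne : (Subtype.val '' {s : S | b s ∈ V}).Nonempty :=
      Set.nonempty_of_ncard_ne_zero (by omega)
    obtain ⟨_, s, hs, -⟩ := hne
    exact ⟨s, hs⟩
  refine ⟨?_, ⊤, V, _, _, by simp, hV3, hunion, hdisj,
    hupb.isUPBIn_of_splitting hab h V hV hfull, hTc, hUc,
    canEliminate_of_splitting hab h.left_ne_zero h.right_ne_zero hupb.orthogonal V hV hne⟩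
  have := h.finite
  rw [hunion, Set.ncard_union_eq hdisj ((Set.toFinite _).image _) ((Set.toFinite _).image _),
    hTc, hUc]
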